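/- A Smale space $(X,\varphi)$ is a compact metric space $(X,d)$ with a homeomorphism $\varphi:X\to X$ for which there exist constants $\varepsilon_X>0$, $0<\lambda<1$ and a continuous map $(x,y)\mapsto[x,y]\in X$, defined on $\{(x,y)\in X\times X : d(x,y)\le\varepsilon_X\}$, such that $[x,x]=x$, $[x,[y,z]]=[x,z]$, $[[x,y],z]=[x,z]$ and $\varphi[x,y]=[\varphi(x),\varphi(y)]$ whenever both sides are defined, and such that, for all $y,z$ with $d(y,z)\le\varepsilon_X$, $d(\varphi(y),\varphi(z))\le\lambda d(y,z)$ if $[y,z]=z$, and $d(\varphi^{-1}(y),\varphi^{-1}(z))\le\lambda d(y,z)$ if $[y,z]=y$. It is irreducible if for all non-empty open sets $U,V\subseteq X$ there is an integer $N>0$ with $\varphi^N(U)\cap V\neq\varnothing$. For $x\in X$ put $X^s(x)=\{y\in X:\lim_{n\to+\infty}d(\varphi^n(x),\varphi^n(y))=0\}$ and $X^u(x)=\{y\in X:\lim_{n\to+\infty}d(\varphi^{-n}(x),\varphi^{-n}(y))=0\}$. A factor map $\pi:(Y,\psi)\to(X,\varphi)$ is a continuous surjection $\pi:Y\to X$ with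 $\pi\circ\psi=\varphi\circ\pi$; it is s-bijective (respectively u-bijective) if for every $y\in Y$ it restricts to a bijection $Y^s(y)\to X^s(\pi(y))$ (respectively $Y^u(y)\to X^u(\pi(y))$). **Theorem.** Let $\pi:(Y,\psi)\to(X,\varphi)$ be a factor map between irreducible Smale spaces that is both s-bijective and u-bijective. Then there is a positive integer $n$ such that $\pi$ is $n$-to-$1$, that is, $\pi^{-1}\{x\}$ has exactly $n$ elements for every $x\in X$. -/

import Mathlib

namespace Smale

open Filter Topology

/-- `br` is a bracket map for the homeomorphism `φ`, with constants `ε` and `lam`. The bracket is a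
total function `X → X → X`, but only its values on `{(x, y) | dist x y ≤ ε}` are constrained: every
axiom carries the hypotheses that say that all the brackets occurring in it are defined. -/
structure IsBracket {X : Type*} [MetricSpace X] (φ : X ≃ₜ X) (ε lam : ℝ) (br : X → X → X) :
    Prop where
  eps_pos : 0 < ε
  lam_pos : 0 < lam
  lam_lt_one : lam < 1
  continuousOn : ContinuousOn (fun p : X × X => br p.1 p.2) {p | dist p.1 p.2 ≤ ε}
  /-- (B1) `[x, x] = x` -/
  br_self : ∀ x, br x x = x
  /-- (B2) `[x, [y, z]] = [x, z]` -/
  br_right : ∀ x y z, dist y z ≤ ε → dist x (br y z) ≤ ε → dist x z ≤ ε →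
    br x (br y z) = br x z
  /-- (B3) `[[x, y], z] = [x, z]` -/
  br_left : ∀ x y z, dist x y ≤ ε → dist (br x y) z ≤ ε → dist x z ≤ ε →
    br (br x y) z = br x z
  /-- (B4) `φ [x, y] = [φ x, φ y]` -/
  map_br : ∀ x y, dist x y ≤ ε → dist (φ x) (φ y) ≤ ε → φ (br x y) = br (φ x) (φ y)
  /-- (C1) `φ` contracts local stable sets -/
  contract_stable : ∀ y z, dist y z ≤ ε → br y z = z → dist (φ y) (φ z) ≤ lam * dist y z
  /-- (C2) the inverse of `φ` contracts local unstable sets -/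
  contract_unstable : ∀ y z, dist y z ≤ ε → br y z = y →
    dist (φ.symm y) (φ.symm z) ≤ lam * dist y z

/-- `(X, φ)` is a Smale space: `X` is a compact metric space and the homeomorphism `φ` admits a
bracket map for some constants. -/
def IsSmaleSpace {X : Type*} [MetricSpace X] (φ : X ≃ₜ X) : Prop :=
  CompactSpace X ∧ ∃ (ε lam : ℝ) (br : X → X → X), IsBracket φ ε lam br

/-- `(X, φ)` is irreducible: for every ordered pair of non-empty open sets `U`, `V` some positive
iterate of `φ` maps a point of `U` into `V`. -/
def IsIrreducible {X : Type*} [TopologicalSpace X] (φ : X ≃ₜ X) : Prop :=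
  ∀ U V : Set X, IsOpen U → IsOpen V → U.Nonempty → V.Nonempty →
    ∃ N : ℕ, 0 < N ∧ ((φ^[N] '' U) ∩ V).Nonempty

/-- The global stable set `X^s(x)`. -/
def stableSet {X : Type*} [MetricSpace X] (φ : X ≃ₜ X) (x : X) : Set X :=
  {y | Tendsto (fun n : ℕ => dist (φ^[n] x) (φ^[n] y)) atTop (𝓝 0)}

/-- The global unstable set `X^u(x)`. -/
def unstableSet {X : Type*} [MetricSpace X] (φ : X ≃ₜ X) (x : X) : Set X :=
  {y | Tendsto (fun n : ℕ => dist (φ.symm^[n] x) (φ.symm^[n] y)) atTop (𝓝 0)}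

/-- `π : (Y, ψ) → (X, φ)` is a factor map: continuous, equivariant and surjective. -/
structure IsFactorMap {Y X : Type*} [TopologicalSpace Y] [TopologicalSpace X]
    (ψ : Y ≃ₜ Y) (φ : X ≃ₜ X) (π : Y → X) : Prop where
  continuous : Continuous π
  semiconj : ∀ y, π (ψ y) = φ (π y)
  surjective : Function.Surjective π

/-- `π` restricts to a bijection `Y^s(y) → X^s(π y)` for every `y`. -/
def IsSBijective {Y X : Type*} [MetricSpace Y] [MetricSpace X]
    (ψ : Y ≃ₜ Y) (φ : X ≃ₜ X) (π : Y → X) : Prop :=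
  ∀ y, Set.BijOn π (stableSet ψ y) (stableSet φ (π y))

/-- `π` restricts to a bijection `Y^u(y) → X^u(π y)` for every `y`. -/
def IsUBijective {Y X : Type*} [MetricSpace Y] [MetricSpace X]
    (ψ : Y ≃ₜ Y) (φ : X ≃ₜ X) (π : Y → X) : Prop :=
  ∀ y, Set.BijOn π (unstableSet ψ y) (unstableSet φ (π y))

/-- `π` is `n`-to-`1`: every fibre has exactly `n` elements. -/
def IsNToOne {Y X : Type*} (n : ℕ) (π : Y → X) : Prop :=
  ∀ x, (π ⁻¹' {x}).encard = n

end Smale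

/-! The map `π` is a covering map, so its fibre cardinality is locally constant; it is also
`φ`-invariant, and irreducibility makes it constant. Fibres are compact and discrete, hence finite.
The covering property rests on `π[a, b] = [π a, π b]` for close `a, b`, which follows from
expansiveness of `X`. If moreover `π a = π b`, then `[a, b]` has the same image as `a`, to which it
is stably equivalent, and as `b`, to which it is unstably equivalent; so `a = [a, b] = b`, and `π`
is locally injective. It is open because the stable and unstable coordinates of a point near `π y`
lift near `y`, and the bracket of the lifts is a local section. -/

namespace Smale

open Filter Topology Function Set

/-! ### Local product structure and expansiveness -/

namespace IsBracket

variable {X : Type*} [MetricSpace X] {φ : X ≃ₜ X} {ε lam : ℝ} {br : X → X → X}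

/-- Reversing time exchanges the two arguments of the bracket. -/
theorem symm (h : IsBracket φ ε lam br) : IsBracket φ.symm ε lam (fun x y => br y x) where
  eps_pos := h.eps_pos
  lam_pos := h.lam_pos
  lam_lt_one := h.lam_lt_one
  continuousOn := h.continuousOn.comp continuous_swap.continuousOn
    (fun p (hp : dist p.1 p.2 ≤ ε) => by
      rw [dist_comm] at hp
      exact hp)
  br_self := h.br_self
  br_right x y z hyz hx hxz := h.br_left z y x (by rwa [dist_comm]) (by rwa [dist_comm])
    (by rwa [dist_comm])
  br_left x y z hxy hz hxz := h.br_right z y x (by rwa [dist_comm]) (by rwa [dist_comm])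
    (by rwa [dist_comm])
  map_br x y hxy hφ := by
    rw [φ.symm_apply_eq, h.map_br _ _ (by rwa [dist_comm])]
    · simp
    · simpa [dist_comm] using hxy
  contract_stable y z hyz hbr := by
    rw [dist_comm, dist_comm y]
    exact h.contract_unstable z y (by rwa [dist_comm]) hbr
  contract_unstable y z hyz hbr := by
    rw [dist_comm, dist_comm y]
    exact h.contract_stable z y (by rwa [dist_comm]) hbr

theorem exists_br_near [CompactSpace X] (h : IsBracket φ ε lam br) {δ : ℝ} (hδ : 0 < δ) :
    ∃ η > 0, ∀ x y, dist x y < η →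
      dist x y ≤ ε ∧ dist x (br x y) < δ ∧ dist (br x y) y < δ := by
  have hK : IsCompact {p : X × X | dist p.1 p.2 ≤ ε} :=
    (isClosed_le continuous_dist continuous_const).isCompact
  have huc := hK.uniformContinuousOn_of_continuous h.continuousOn
  rw [Metric.uniformContinuousOn_iff] at huc
  obtain ⟨η, hη, H⟩ := huc δ hδ
  refine ⟨min η ε, lt_min hη h.eps_pos, fun x y hxy => ?_⟩
  have h1 : dist x y < η := hxy.trans_le (min_le_left _ _)
  have h2 : dist x y ≤ ε := hxy.le.trans (min_le_right _ _)
  have hx : dist x x ≤ ε := by simpa using h.eps_pos.le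
  have hy : dist y y ≤ ε := by simpa using h.eps_pos.le
  refine ⟨h2, ?_, ?_⟩
  · have := H (x, x) hx (x, y) h2 (by simpa [Prod.dist_eq, dist_comm y x, hη] using h1)
    simpa [h.br_self] using this
  · have := H (x, y) h2 (y, y) hy (by simpa [Prod.dist_eq, hη] using h1)
    simpa [h.br_self] using this

theorem iterate_stable (h : IsBracket φ ε lam br) {y z : X} (hd : dist y z ≤ ε)
    (hbr : br y z = z) (n : ℕ) : dist (φ^[n] y) (φ^[n] z) ≤ lam ^ n * dist y z ∧
      br (φ^[n] y) (φ^[n] z) = φ^[n] z := by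
  induction n with
  | zero => simpa using hbr
  | succ n ih =>
    obtain ⟨ih1, ih2⟩ := ih
    have hle : dist (φ^[n] y) (φ^[n] z) ≤ ε := ih1.trans <|
      (mul_le_of_le_one_left dist_nonneg (pow_le_one₀ h.lam_pos.le h.lam_lt_one.le)).trans hd
    have hc := h.contract_stable _ _ hle ih2
    rw [iterate_succ_apply', iterate_succ_apply']
    refine ⟨hc.trans ?_, ?_⟩
    · rw [pow_succ', mul_assoc]
      exact mul_le_mul_of_nonneg_left ih1 h.lam_pos.le
    · rw [← h.map_br _ _ hle, ih2]
      exact hc.trans ((mul_le_of_le_one_left dist_nonneg h.lam_lt_one.le).trans hle)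

theorem mem_stableSet (h : IsBracket φ ε lam br) {y z : X} (hd : dist y z ≤ ε)
    (hbr : br y z = z) : z ∈ stableSet φ y := by
  refine squeeze_zero (fun _ => dist_nonneg) (fun n => (h.iterate_stable hd hbr n).1) ?_
  simpa using (tendsto_pow_atTop_nhds_zero_of_lt_one h.lam_pos.le h.lam_lt_one).mul_const _

/-- Since `[x, [x, y]] = [x, y]`, the point `[x, y]` lies in the local stable set of `x`, where
forward iterates contract. -/
theorem exists_br_stable [CompactSpace X] (h : IsBracket φ ε lam br) {δ : ℝ} (hδ : 0 < δ) :
    ∃ η > 0, ∀ x y, dist x y < η →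
      br x y ∈ stableSet φ x ∧ ∀ n, dist (φ^[n] x) (φ^[n] (br x y)) < δ := by
  obtain ⟨η, hη, H⟩ := h.exists_br_near (lt_min hδ h.eps_pos)
  refine ⟨η, hη, fun x y hxy => ?_⟩
  obtain ⟨h1, h2, -⟩ := H x y hxy
  have h3 : dist x (br x y) ≤ ε := h2.le.trans (min_le_right _ _)
  have h4 : br x (br x y) = br x y := h.br_right x x y h1 h3 h1
  refine ⟨h.mem_stableSet h3 h4, fun n => ((h.iterate_stable h3 h4 n).1.trans ?_).trans_lt
    (h2.trans_le (min_le_left _ _))⟩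
  exact mul_le_of_le_one_left dist_nonneg (pow_le_one₀ h.lam_pos.le h.lam_lt_one.le)

/-- The bracket commutes with all backward iterates, so `a` and `[a, b]` are the `n`-th forward
images of stably related points at distance at most `ε`; hence they are within `lam ^ n * ε` for
every `n`. -/
theorem exists_br_eq_left [CompactSpace X] (h : IsBracket φ ε lam br) :
    ∃ η > 0, ∀ a b, (∀ n, dist (φ.symm^[n] a) (φ.symm^[n] b) < η) → br a b = a := by
  obtain ⟨η, hη, H⟩ := h.exists_br_near h.eps_pos
  refine ⟨η, hη, fun a b hab => ?_⟩
  have hbr (n : ℕ) : φ.symm^[n] (br a b) = br (φ.symm^[n] a) (φ.symm^[n] b) := by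
    induction n with
    | zero => rfl
    | succ n ih =>
      have h1 := (H _ _ (hab n)).1
      have h2 := (H _ _ (hab (n + 1))).1
      rw [iterate_succ_apply', iterate_succ_apply'] at h2
      rw [iterate_succ_apply', iterate_succ_apply', iterate_succ_apply', ih]
      exact h.symm.map_br _ _ (by rwa [dist_comm]) (by rwa [dist_comm])
  have hle (n : ℕ) : dist a (br a b) ≤ lam ^ n * ε := by
    obtain ⟨h1, h2, -⟩ := H _ _ (hab n)
    have h3 := (h.iterate_stable h2.le (h.br_right _ _ _ h1 h2.le h1) n).1
    rw [← hbr, (LeftInverse.iterate φ.apply_symm_apply n) a,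
      (LeftInverse.iterate φ.apply_symm_apply n) (br a b)] at h3
    refine h3.trans (mul_le_mul_of_nonneg_left ?_ (pow_nonneg h.lam_pos.le n))
    rw [hbr]
    exact h2.le
  have hlim : Tendsto (fun n : ℕ => lam ^ n * ε) atTop (𝓝 0) := by
    simpa using (tendsto_pow_atTop_nhds_zero_of_lt_one h.lam_pos.le h.lam_lt_one).mul_const ε
  exact (dist_le_zero.1 (ge_of_tendsto' hlim hle)).symm

/-- Smale spaces are expansive. -/
theorem exists_expansive [CompactSpace X] (h : IsBracket φ ε lam br) :
    ∃ η > 0, ∀ a b, (∀ n, dist (φ^[n] a) (φ^[n] b) < η) →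
      (∀ n, dist (φ.symm^[n] a) (φ.symm^[n] b) < η) → a = b := by
  obtain ⟨η₁, hη₁, H₁⟩ := h.exists_br_eq_left
  obtain ⟨η₂, hη₂, H₂⟩ := h.symm.exists_br_eq_left
  refine ⟨min η₁ η₂, lt_min hη₁ hη₂, fun a b hf hb => ?_⟩
  rw [← H₁ a b fun n => (hb n).trans_le (min_le_left _ _)]
  exact H₂ b a fun n => by
    rw [dist_comm]
    exact (hf n).trans_le (min_le_right _ _)

theorem tendsto_br (h : IsBracket φ ε lam br) {ι : Type*} {l : Filter ι} {f g : ι → X} {x : X}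
    (hf : Tendsto f l (𝓝 x)) (hg : Tendsto g l (𝓝 x)) :
    Tendsto (fun i => br (f i) (g i)) l (𝓝 x) := by
  have hmem : {p : X × X | dist p.1 p.2 ≤ ε} ∈ 𝓝 (x, x) := by
    filter_upwards [(isOpen_lt (continuous_dist (α := X)) continuous_const).mem_nhds
      (show dist x x < ε by simpa using h.eps_pos)] with p hp
    exact le_of_lt hp
  have hc : Tendsto (fun p : X × X => br p.1 p.2) (𝓝 (x, x)) (𝓝 (br x x)) :=
    h.continuousOn.continuousAt hmem
  rw [h.br_self] at hc
  exact hc.comp (hf.prodMk_nhds hg)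

theorem eventually_dist_le (h : IsBracket φ ε lam br) {ι : Type*} {l : Filter ι} {f g : ι → X}
    {x : X} (hf : Tendsto f l (𝓝 x)) (hg : Tendsto g l (𝓝 x)) :
    ∀ᶠ i in l, dist (f i) (g i) ≤ ε := by
  have := hf.dist hg
  rw [dist_self] at this
  exact (this.eventually_lt_const h.eps_pos).mono fun _ => le_of_lt

/-- A point near `x` is recovered from its unstable and stable coordinates at `x`. -/
theorem eventually_br_br (h : IsBracket φ ε lam br) (x : X) :
    ∀ᶠ x' in 𝓝 x, br (br x' x) (br x x') = x' := by
  have hid : Tendsto (fun x' : X => x') (𝓝 x) (𝓝 x) := tendsto_id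
  have hx : Tendsto (fun _ : X => x) (𝓝 x) (𝓝 x) := tendsto_const_nhds
  have hl := h.tendsto_br hid hx
  have hr := h.tendsto_br hx hid
  filter_upwards [h.eventually_dist_le hid hx, h.eventually_dist_le hx hid,
    h.eventually_dist_le hl hr, h.eventually_dist_le hid hr] with x' h1 h2 h3 h4
  rw [h.br_left _ _ _ h1 h3 h4, h.br_right _ _ _ h2 h4 (by simpa using h.eps_pos.le), h.br_self]

end IsBracket

/-! ### Factor maps, local injectivity and openness -/

section FactorMap

variable {Y X : Type*} [MetricSpace Y] [MetricSpace X] {ψ : Y ≃ₜ Y} {φ : X ≃ₜ X} {π : Y → X}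
  {εY lamY εX lamX : ℝ} {brY : Y → Y → Y} {brX : X → X → X}

theorem IsFactorMap.symm (hπ : IsFactorMap ψ φ π) : IsFactorMap ψ.symm φ.symm π where
  continuous := hπ.continuous
  semiconj y := by
    rw [φ.eq_symm_apply, ← hπ.semiconj, ψ.apply_symm_apply]
  surjective := hπ.surjective

theorem IsFactorMap.iterate (hπ : IsFactorMap ψ φ π) (n : ℕ) (y : Y) :
    π (ψ^[n] y) = φ^[n] (π y) :=
  Semiconj.iterate_right (f := π) hπ.semiconj n y

theorem stableSet_symm {x y : Y} (h : y ∈ stableSet ψ x) : x ∈ stableSet ψ y := by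
  simpa only [stableSet, mem_ofPred_eq, dist_comm] using h

theorem stableSet_trans {x y z : Y} (h : y ∈ stableSet ψ x) (h' : z ∈ stableSet ψ y) :
    z ∈ stableSet ψ x :=
  squeeze_zero (fun _ => dist_nonneg) (fun _ => dist_triangle _ _ _) (by simpa using h.add h')

variable [CompactSpace Y] [CompactSpace X]

/-- Both forward orbits stay within `δ / 2` of that of `π a`. -/
theorem IsFactorMap.exists_iterate_br_near (hπ : IsFactorMap ψ φ π)
    (hY : IsBracket ψ εY lamY brY) (hX : IsBracket φ εX lamX brX) {δ : ℝ} (hδ : 0 < δ) :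
    ∃ η > 0, ∀ a b, dist a b < η →
      ∀ n, dist (φ^[n] (π (brY a b))) (φ^[n] (brX (π a) (π b))) < δ := by
  have huc := Metric.uniformContinuous_iff.1 (CompactSpace.uniformContinuous_of_continuous
    hπ.continuous)
  obtain ⟨α, hα, hα'⟩ := huc (δ / 2) (half_pos hδ)
  obtain ⟨β, hβ, hβ'⟩ := hY.exists_br_stable hα
  obtain ⟨γ, hγ, hγ'⟩ := hX.exists_br_stable (half_pos hδ)
  obtain ⟨θ, hθ, hθ'⟩ := huc γ hγ
  refine ⟨min β θ, lt_min hβ hθ, fun a b hab n => ?_⟩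
  have h1 := hα' ((hβ' a b (hab.trans_le (min_le_left _ _))).2 n)
  have h2 := (hγ' (π a) (π b) (hθ' (hab.trans_le (min_le_right _ _)))).2 n
  rw [hπ.iterate, hπ.iterate, dist_comm] at h1
  linarith [dist_triangle (φ^[n] (π (brY a b))) (φ^[n] (π a)) (φ^[n] (brX (π a) (π b)))]

/-- Factor maps between Smale spaces preserve the bracket of nearby points. -/
theorem IsFactorMap.exists_map_br (hπ : IsFactorMap ψ φ π)
    (hY : IsBracket ψ εY lamY brY) (hX : IsBracket φ εX lamX brX) :
    ∃ η > 0, ∀ a b, dist a b < η → π (brY a b) = brX (π a) (π b) := by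
  obtain ⟨δ, hδ, H⟩ := hX.exists_expansive
  obtain ⟨η₁, hη₁, H₁⟩ := hπ.exists_iterate_br_near hY hX hδ
  obtain ⟨η₂, hη₂, H₂⟩ := hπ.symm.exists_iterate_br_near hY.symm hX.symm hδ
  refine ⟨min η₁ η₂, lt_min hη₁ hη₂, fun a b hab => H _ _ ?_ ?_⟩
  · exact H₁ a b (hab.trans_le (min_le_left _ _))
  · exact H₂ b a (by
      rw [dist_comm]
      exact hab.trans_le (min_le_right _ _))

theorem IsFactorMap.exists_injective_near (hπ : IsFactorMap ψ φ π)
    (hY : IsBracket ψ εY lamY brY) (hX : IsBracket φ εX lamX brX)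
    (hs : IsSBijective ψ φ π) (hu : IsUBijective ψ φ π) :
    ∃ η > 0, ∀ a b, dist a b < η → π a = π b → a = b := by
  obtain ⟨η₁, hη₁, H₁⟩ := hπ.exists_map_br hY hX
  obtain ⟨η₂, hη₂, H₂⟩ := hY.exists_br_stable one_pos
  obtain ⟨η₃, hη₃, H₃⟩ := hY.symm.exists_br_stable one_pos
  have self_stable (ρ : Y ≃ₜ Y) (y : Y) : y ∈ stableSet ρ y := by simp [stableSet]
  refine ⟨min η₁ (min η₂ η₃), lt_min hη₁ (lt_min hη₂ hη₃), fun a b hab he => ?_⟩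
  simp only [lt_min_iff] at hab
  have h1 : π (brY a b) = π a := by rw [H₁ a b hab.1, he, hX.br_self]
  have ha : brY a b = a := (hs a).injOn (H₂ a b hab.2.1).1 (self_stable ψ a) h1
  have hb : brY a b = b := (hu b).injOn (H₃ b a (by rw [dist_comm]; exact hab.2.2)).1
    (self_stable ψ.symm b) (h1.trans he)
  exact ha.symm.trans hb

/-- The lifts of local stable sets are continuous at the base point. -/
theorem IsFactorMap.exists_stable_lift (hπ : IsFactorMap ψ φ π)
    (hY : IsBracket ψ εY lamY brY) (hX : IsBracket φ εX lamX brX)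
    (hs : IsSBijective ψ φ π)
    (hinj : ∃ η > 0, ∀ a b, dist a b < η → π a = π b → a = b) (y : Y) :
    ∃ f : X → Y, Tendsto f (𝓝 (π y)) (𝓝 y) ∧ ∀ᶠ x in 𝓝 (π y), π (f x) = brX (π y) x := by
  obtain ⟨η, hη, hinj⟩ := hinj
  obtain ⟨η₁, hη₁, hmap⟩ := hπ.exists_map_br hY hX
  obtain ⟨η₂, hη₂, hst⟩ := hY.exists_br_stable one_pos
  obtain ⟨η₃, hη₃, hstX⟩ := hX.exists_br_stable one_pos
  have hlift (x : X) : ∃ a, dist (π y) x < η₃ → a ∈ stableSet ψ y ∧ π a = brX (π y) x := by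
    by_cases hx : dist (π y) x < η₃
    · obtain ⟨a, ha, hax⟩ := (hs y).surjOn (hstX _ _ hx).1
      exact ⟨a, fun _ => ⟨ha, hax⟩⟩
    · exact ⟨y, fun h => absurd h hx⟩
  choose f hf using hlift
  have hnear : ∀ᶠ x in 𝓝 (π y), dist (π y) x < η₃ := by
    filter_upwards [Metric.ball_mem_nhds (π y) hη₃] with x hx using Metric.mem_ball'.1 hx
  -- By compactness of `Y` the lifts converge along any ultrafilter, to some `a`; it remains to show
  -- `a = y`.
  refine ⟨f, tendsto_iff_ultrafilter _ _ _ |>.2 fun U hU => ?_, hnear.mono fun x hx => (hf x hx).2⟩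
  obtain ⟨a, -, ha⟩ := isCompact_univ.ultrafilter_le_nhds (U.map f) (by simp)
  have ha : Tendsto f U (𝓝 a) := ha
  have hid : Tendsto (fun x : X => x) U (𝓝 (π y)) := hU
  have hbr : Tendsto (fun x => brX (π y) x) U (𝓝 (π y)) :=
    hX.tendsto_br tendsto_const_nhds hid
  have hUnear : ∀ᶠ x in U, dist (π y) x < η₃ := hU hnear
  have hπa : π a = π y := by
    refine tendsto_nhds_unique ((hπ.continuous.tendsto a).comp ha) (hbr.congr' ?_)
    filter_upwards [hUnear] with x hx using (hf x hx).2.symm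
  have hdist : Tendsto (fun x => dist a (f x)) U (𝓝 0) := by
    simpa using (tendsto_const_nhds (x := a)).dist ha
  have hdist' : Tendsto (fun x => dist (brY a (f x)) (f x)) U (𝓝 0) := by
    simpa using (hY.tendsto_br tendsto_const_nhds ha).dist ha
  obtain ⟨x, h1, h2, h3, h4, h5, h6⟩ := (hUnear.and <| (hdist.eventually_lt_const hη₁).and <|
    (hdist.eventually_lt_const hη₂).and <| (hdist'.eventually_lt_const hη).and <|
    (hX.eventually_dist_le tendsto_const_nhds hid).and
    (hX.eventually_dist_le tendsto_const_nhds hbr)).exists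
  obtain ⟨hfx, hfx'⟩ := hf x h1
  -- Both sides project to `[π y, x]`, so local injectivity applies. Thus `f x` is stably equivalent
  -- to `a` as well as to `y`, and injectivity on stable sets gives `y = a`.
  have hfix : brY a (f x) = f x := by
    refine hinj _ _ h4 ?_
    rw [hmap _ _ h2, hπa, hfx', hX.br_right _ _ _ h5 h6 h5]
  have hmem : f x ∈ stableSet ψ a := by
    rw [← hfix]
    exact (hst _ _ h3).1
  have : y = a := by
    refine (hs a).injOn (stableSet_trans hmem (stableSet_symm hfx)) ?_ hπa.symm
    simp [stableSet]
  rw [this]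
  exact ha

theorem IsFactorMap.isOpenMap (hπ : IsFactorMap ψ φ π)
    (hY : IsBracket ψ εY lamY brY) (hX : IsBracket φ εX lamX brX)
    (hs : IsSBijective ψ φ π) (hu : IsUBijective ψ φ π) : IsOpenMap π := by
  rw [isOpenMap_iff_nhds_le]
  intro y
  have hinj := hπ.exists_injective_near hY hX hs hu
  obtain ⟨η, hη, hmap⟩ := hπ.exists_map_br hY hX
  obtain ⟨f, hf, hf'⟩ := hπ.exists_stable_lift hY hX hs hinj y
  obtain ⟨g, hg, hg'⟩ := hπ.symm.exists_stable_lift hY.symm hX.symm hu hinj y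
  have hdist : Tendsto (fun x => dist (g x) (f x)) (𝓝 (π y)) (𝓝 0) := by
    simpa using hg.dist hf
  have hsection : (fun x => π (brY (g x) (f x))) =ᶠ[𝓝 (π y)] id := by
    filter_upwards [hf', hg', hdist.eventually_lt_const hη, hX.eventually_br_br (π y)]
      with x h1 h2 h3 h4
    rw [hmap _ _ h3, h1, h2]
    exact h4
  calc 𝓝 (π y) = map (fun x => π (brY (g x) (f x))) (𝓝 (π y)) := by
        rw [map_congr hsection, map_id]
    _ = map π (map (fun x => brY (g x) (f x)) (𝓝 (π y))) := map_map.symm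
    _ ≤ map π (𝓝 y) := map_mono (hY.tendsto_br hg hf)

theorem IsFactorMap.isCoveringMap (hπ : IsFactorMap ψ φ π)
    (hY : IsBracket ψ εY lamY brY) (hX : IsBracket φ εX lamX brX)
    (hs : IsSBijective ψ φ π) (hu : IsUBijective ψ φ π) : IsCoveringMap π := by
  -- Compactness of `Y` reduces the covering property to being a local homeomorphism.
  rw [← isLocalHomeomorph_iff_isCoveringMap, isLocalHomeomorph_iff_isOpenEmbedding_restrict]
  intro y
  obtain ⟨η, hη, hinj⟩ := hπ.exists_injective_near hY hX hs hu
  refine ⟨Metric.ball y (η / 2), Metric.ball_mem_nhds y (half_pos hη),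
    .of_continuous_injective_isOpenMap (hπ.continuous.comp continuous_subtype_val) ?_
      ((hπ.isOpenMap hY hX hs hu).domRestrict Metric.isOpen_ball)⟩
  rintro ⟨a, ha⟩ ⟨b, hb⟩ hab
  refine Subtype.ext (hinj a b ?_ hab)
  rw [Metric.mem_ball] at ha hb
  linarith [dist_triangle_right a b y]

end FactorMap

end Smale

/-! ### Constancy of the fibre cardinality -/

theorem IsCoveringMap.isLocallyConstant_encard_fiber {E X : Type*} [TopologicalSpace E]
    [TopologicalSpace X] {f : E → X} (hf : IsCoveringMap f) :
    IsLocallyConstant fun x => (f ⁻¹' {x}).encard := by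
  rw [IsLocallyConstant.iff_exists_open]
  intro x
  obtain ⟨hdisc, U, hxU, hU, hfU, H⟩ := hf x
  refine ⟨U, hU, hxU, fun x' hx' => ?_⟩
  -- The trivialization around `x` also serves `x'`, with the fibre over `x` as model.
  have hcov : IsEvenlyCovered f x' (f ⁻¹' {x}) := ⟨hdisc, U, hx', hU, hfU, H⟩
  exact Set.encard_congr hcov.fiberHomeomorph.toEquiv.symm

theorem Smale.IsFactorMap.encard_fiber_map {Y X : Type*} [MetricSpace Y] [MetricSpace X]
    {ψ : Y ≃ₜ Y} {φ : X ≃ₜ X} {π : Y → X} (hπ : Smale.IsFactorMap ψ φ π) (x : X) :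
    (π ⁻¹' {φ x}).encard = (π ⁻¹' {x}).encard := by
  rw [← ψ.injective.encard_image (π ⁻¹' {x})]
  congr 1
  ext y
  rw [ψ.image_eq_preimage_symm, Set.mem_preimage, Set.mem_preimage, Set.mem_preimage,
    Set.mem_singleton_iff, Set.mem_singleton_iff, hπ.symm.semiconj, φ.symm_apply_eq]

/-- A locally constant invariant function of an irreducible system is constant. -/
theorem Smale.IsIrreducible.eq_of_isLocallyConstant {X α : Type*} [TopologicalSpace X]
    {φ : X ≃ₜ X} (h : Smale.IsIrreducible φ) {g : X → α} (hg : IsLocallyConstant g)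
    (hinv : ∀ x, g (φ x) = g x) (x y : X) : g y = g x := by
  obtain ⟨N, -, -, ⟨z, hz, rfl⟩, hN⟩ :=
    h (g ⁻¹' {g x}) (g ⁻¹' {g y}) (hg _) (hg _) ⟨x, rfl⟩ ⟨y, rfl⟩
  have hit (n : ℕ) : g (φ^[n] z) = g z := by
    induction n with
    | zero => rfl
    | succ n ih => rw [Function.iterate_succ_apply', hinv, ih]
  rw [Set.mem_preimage, Set.mem_singleton_iff] at hz hN
  rw [← hN, hit, hz]

theorem theorem3p2 {Y X : Type*} [MetricSpace Y] [MetricSpace X]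
    (ψ : Y ≃ₜ Y) (φ : X ≃ₜ X)
    (hY : Smale.IsSmaleSpace ψ) (hX : Smale.IsSmaleSpace φ)
    (hYirr : Smale.IsIrreducible ψ) (hXirr : Smale.IsIrreducible φ)
    (π : Y → X) (hπ : Smale.IsFactorMap ψ φ π)
    (hs : Smale.IsSBijective ψ φ π) (hu : Smale.IsUBijective ψ φ π) :
    ∃ n : ℕ, 0 < n ∧ Smale.IsNToOne n π := by
  obtain ⟨_, εY, lamY, brY, hY⟩ := hY
  obtain ⟨_, εX, lamX, brX, hX⟩ := hX
  rcases isEmpty_or_nonempty X with hE | ⟨⟨x⟩⟩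
  · exact ⟨1, one_pos, fun x => hE.elim x⟩
  have hcov := hπ.isCoveringMap hY hX hs hu
  have hcomp : IsCompact (π ⁻¹' {x}) := (isClosed_singleton.preimage hπ.continuous).isCompact
  have hfin : (π ⁻¹' {x}).Finite := by
    have := (hcov x).1
    exact hcomp.finite ⟨this⟩
  refine ⟨(π ⁻¹' {x}).ncard, (Set.ncard_pos hfin).2 (hπ.surjective x), fun x' => ?_⟩
  rw [hfin.cast_ncard_eq]
  exact hXirr.eq_of_isLocallyConstant hcov.isLocallyConstant_encard_fiber hπ.encard_fiber_map x x'
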